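/- Let $(\Omega,\mathcal F,P)$ be a probability space with a filtration $(\mathcal F_t)$, let $T\ge 0$ and $J\ge 0$ be integers, and let $\delta>0$ be the length of a day (e.g. $\delta=1/360$). For $j=1,\dots,J$ let $(t_0^j,t_1^j)$ be reference periods with integers $0\le t_0^j<t_1^j$ and $T<t_1^j$. For each $t=0,\dots,T$, let the forward curve at time $t$ be given by real $\mathcal F_t$-measurable random variables $F_t(s)$, where $s$ is an integer number of days ahead (negative $s$ matter only if $t>t_0^j$ for some $j$), and put $$G_t^j=\sum_{s=t_0^j-t}^{t_1^j-t-1}F_t(s)\delta,\qquad F_t(t_0^j,t_1^j)=\frac{1}{(t_1^j-t_0^j)\delta}\bigl[\exp(G_t^j)-1\bigr].$$ Assume that at each time $t=0,\dots,T$ the $J$ futures contracts can be traded without bid-ask spreads at the futures rates $F_t(t_0^j,t_1^j)$: a position $z\in\mathbb R$ entered at time $t$ in contract $j$ costs nothing and pays $z\,[R(t_0^j,t_1^j)-F_t(t_0^j,t_1^j)]$ at $t_1^j$, where $$R(t_0,t_1)=\frac{1}{(t_1-t_0)\delta}\Bigl[\prod_{t=t_0}^{t_1-1}(1+r_t\delta)-1\Bigr]$$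 is the geometric average of the overnight (SOFR) rates $r_t$. A trading strategy is an adapted $\mathbb R^J$-valued process $z=(z_t)_{t=0}^T$ whose positions are closed at $T$, i.e. $\sum_{t=0}^T z_t^j=0$ almost surely for every $j$. Its payout is $C(z)=\sum_{j=1}^J\sum_{t=0}^T z_t^j[R(t_0^j,t_1^j)-F_t(t_0^j,t_1^j)]$. The market is called arbitrage-free if every trading strategy $z$ with $C(z)\ge 0$ almost surely satisfies $C(z)=0$ almost surely. Then the market is arbitrage-free if and only if, for every $t=0,\dots,T-1$, almost surely $$\exp\bigl((G_t^j)_{j=1}^J\bigr)\in\mathrm{ri}\,\mathrm{co}\,\exp\bigl(\mathrm{supp}_t\,(G_{t+1}^j)_{j=1}^J\bigr).$$ Here $\exp$ acts componentwise, $\mathrm{co}$ is the convex hull, $\mathrm{ri}$ is the relative interior, and $\mathrm{supp}_t X$, the $\mathcal F_t$-conditional support of a random vector $X$, is the (up to null sets unique) smallest closed-valued $\mathcal F_t$-measurable set-valued mapping $S$ with $X\in S$ almost surely; $\mathcal F_t$-measurable means that $\{\omega: S(\omega)\cap U\ne\emptyset\}\in\mathcal F_t$ for every open $U$. -/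

import Mathlib

open MeasureTheory ProbabilityTheory Filter Topology Set

namespace SofrFutures

/-! ### Conditional support of a random vector -/

section CondSupport

variable {Ω : Type*} {d : ℕ}

/-- A set-valued mapping is `m`-measurable if the inverse images of open sets belong to `m`. -/
def MeasurableMapping (m : MeasurableSpace Ω) (S : Ω → Set (Fin d → ℝ)) : Prop :=
  ∀ U : Set (Fin d → ℝ), IsOpen U → MeasurableSet[m] {ω | (S ω ∩ U).Nonempty}

/-- `S` is (a version of) the `m`-conditional support of the random vector `X`: it is the smallest
closed-valued `m`-measurable mapping with `X ∈ S` almost surely.  As usual, random sets are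
compared up to null sets. -/
structure IsCondSupport (m : MeasurableSpace Ω) {mΩ : MeasurableSpace Ω} (P : Measure Ω) (X : Ω → Fin d → ℝ)
    (S : Ω → Set (Fin d → ℝ)) : Prop where
  isClosed : ∀ ω, IsClosed (S ω)
  measurable : MeasurableMapping m S
  mem : ∀ᵐ ω ∂P, X ω ∈ S ω
  le : ∀ S' : Ω → Set (Fin d → ℝ), (∀ ω, IsClosed (S' ω)) → MeasurableMapping m S' →
    (∀ᵐ ω ∂P, X ω ∈ S' ω) → ∀ᵐ ω ∂P, S ω ⊆ S' ω

/-- The conditional support is unique up to null sets. -/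
theorem IsCondSupport.ae_eq {m mΩ : MeasurableSpace Ω} {P : Measure Ω} {X : Ω → Fin d → ℝ}
    {S S' : Ω → Set (Fin d → ℝ)} (h : IsCondSupport m P X S) (h' : IsCondSupport m P X S') :
    ∀ᵐ ω ∂P, S ω = S' ω := by
  filter_upwards [h.le S' h'.isClosed h'.measurable h'.mem,
    h'.le S h.isClosed h.measurable h.mem] with ω h₁ h₂
  exact h₁.antisymm h₂

/-- The conditional support exists. -/
theorem exists_isCondSupport {m mΩ : MeasurableSpace Ω} (hm : m ≤ mΩ) (P : Measure Ω)
    [IsProbabilityMeasure P] {X : Ω → Fin d → ℝ} (hX : Measurable X) :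
    ∃ S, IsCondSupport m P X S := by
  have hid : @Measurable Ω Ω mΩ m id := measurable_id'' hm
  let κ : @Kernel Ω (Fin d → ℝ) m _ := @condDistrib Ω Ω (Fin d → ℝ) _ _ _ mΩ m X id P _
  have hκ : ∀ (A : Set Ω) (U : Set (Fin d → ℝ)), MeasurableSet[m] A → MeasurableSet U →
      ∫⁻ ω in A, κ ω U ∂P = P (A ∩ X ⁻¹' U) := by
    intro A U hA hU
    have h := setLIntegral_preimage_condDistrib (mβ := m) (μ := P) hid hX.aemeasurable hU hA
    simpa using h
  have hκm : ∀ U : Set (Fin d → ℝ), MeasurableSet U → Measurable[m] (fun ω => κ ω U) :=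
    fun U hU => Kernel.measurable_coe κ hU
  let B := TopologicalSpace.countableBasis (Fin d → ℝ)
  have hB := TopologicalSpace.isBasis_countableBasis (Fin d → ℝ)
  have hBc : B.Countable := TopologicalSpace.countable_countableBasis (Fin d → ℝ)
  refine ⟨fun ω => (κ ω).support, fun ω => Measure.isClosed_support, ?_, ?_, ?_⟩
  · intro U hU
    have : {ω | ((κ ω).support ∩ U).Nonempty} = {ω | κ ω U = 0}ᶜ := by
      ext ω
      simp only [mem_ofPred_eq, mem_compl_iff]
      constructor
      · rintro ⟨x, hx, hxU⟩
        exact ((Measure.mem_support_iff_forall x).1 hx U (hU.mem_nhds hxU)).ne'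
      · intro h
        rw [inter_comm]
        exact Measure.nonempty_inter_support_of_pos (pos_iff_ne_zero.2 h)
    rw [this]
    exact ((hκm U hU.measurableSet) (measurableSet_singleton 0)).compl
  · have h : ∀ᵐ ω ∂P, ∀ U ∈ B, κ ω U = 0 → X ω ∉ U := by
      rw [ae_ball_iff hBc]
      intro U hUB
      have hU := (hB.isOpen hUB).measurableSet
      have hA : MeasurableSet[m] {ω | κ ω U = 0} := hκm U hU (measurableSet_singleton 0)
      have h0 : P ({ω | κ ω U = 0} ∩ X ⁻¹' U) = 0 := by
        rw [← hκ _ U hA hU]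
        rw [setLIntegral_congr_fun (hm _ hA) (g := fun _ => 0) (fun ω hω => hω)]
        simp
      filter_upwards [measure_eq_zero_iff_ae_notMem.1 h0] with ω hω h1 h2
      exact hω ⟨h1, h2⟩
    filter_upwards [h] with ω hω
    by_contra hx
    obtain ⟨V, hV, hV0⟩ := Measure.notMem_support_iff_exists.1 hx
    obtain ⟨U, hUB, hxU, hUV⟩ := hB.mem_nhds_iff.1 hV
    exact hω U hUB (measure_mono_null hUV hV0) hxU
  · intro S' hS'c hS'm hS'
    have h : ∀ᵐ ω ∂P, ∀ U ∈ B, ¬ (S' ω ∩ U).Nonempty → κ ω U = 0 := by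
      rw [ae_ball_iff hBc]
      intro U hUB
      have hU := hB.isOpen hUB
      have hA : MeasurableSet[m] {ω | (S' ω ∩ U).Nonempty}ᶜ := (hS'm U hU).compl
      have h0 : ∫⁻ ω in {ω | (S' ω ∩ U).Nonempty}ᶜ, κ ω U ∂P = 0 := by
        rw [hκ _ U hA hU.measurableSet, measure_eq_zero_iff_ae_notMem]
        filter_upwards [hS'] with ω hω h1
        exact h1.1 ⟨X ω, hω, h1.2⟩
      have hmeas : Measurable (fun ω => κ ω U) := (hκm U hU.measurableSet).mono hm le_rfl
      rw [lintegral_eq_zero_iff hmeas] at h0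
      exact (ae_restrict_iff' (hm _ hA)).1 h0
    filter_upwards [h] with ω hω x hx
    by_contra hxS
    obtain ⟨U, hUB, hxU, hUS⟩ := hB.mem_nhds_iff.1 ((hS'c ω).isOpen_compl.mem_nhds hxS)
    refine ((Measure.mem_support_iff_forall x).1 hx U ((hB.isOpen hUB).mem_nhds hxU)).ne'
      (hω U hUB ?_)
    rintro ⟨y, hy, hyU⟩
    exact hUS hyU hy

open Classical in
/-- The `m`-conditional support of the random vector `X` (a version of it, chosen once and for
all). -/
noncomputable def condSupport (m : MeasurableSpace Ω) {mΩ : MeasurableSpace Ω} (P : Measure Ω)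
    (X : Ω → Fin d → ℝ) :
    Ω → Set (Fin d → ℝ) :=
  if h : ∃ S, IsCondSupport m P X S then h.choose else fun _ => univ

theorem isCondSupport_condSupport {m mΩ : MeasurableSpace Ω} (hm : m ≤ mΩ) (P : Measure Ω)
    [IsProbabilityMeasure P] {X : Ω → Fin d → ℝ} (hX : Measurable X) :
    IsCondSupport m P X (condSupport m P X) := by
  have h := exists_isCondSupport hm P hX
  rw [condSupport, dif_pos h]
  exact h.choose_spec

end CondSupport

/-! ### The futures market -/

section Market

variable {Ω : Type*} {J : ℕ}

/-- `G_t^j = ∑_{s = t₀ - t}^{t₁ - t - 1} F_t(s) δ` for the reference period `(t₀, t₁)`, where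
`F t s` is the overnight forward rate, seen at time `t`, for the night `s` days ahead. -/
noncomputable def logGrowth (δ : ℝ) (F : ℕ → ℤ → Ω → ℝ) (t₀ t₁ : Fin J → ℕ) (t : ℕ) (ω : Ω) :
    Fin J → ℝ :=
  fun j => ∑ s ∈ Finset.Ico ((t₀ j : ℤ) - t) ((t₁ j : ℤ) - t), F t s ω * δ

/-- The futures rates `F_t(t₀, t₁)` implied by the forward curve at time `t`. -/
noncomputable def futuresRate (δ : ℝ) (F : ℕ → ℤ → Ω → ℝ) (t₀ t₁ : Fin J → ℕ) (t : ℕ) (ω : Ω) :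
    Fin J → ℝ :=
  fun j => 1 / (((t₁ j : ℝ) - t₀ j) * δ) *
    (Real.exp (∑ s ∈ Finset.Ico ((t₀ j : ℤ) - t) ((t₁ j : ℤ) - t), F t s ω * δ) - 1)

/-- The geometric SOFR averages `R(t₀, t₁)` of the overnight rates `r t`. -/
noncomputable def sofrAverage (δ : ℝ) (r : ℕ → Ω → ℝ) (t₀ t₁ : Fin J → ℕ) (ω : Ω) :
    Fin J → ℝ :=
  fun j => 1 / (((t₁ j : ℝ) - t₀ j) * δ) * (∏ t ∈ Finset.Ico (t₀ j) (t₁ j), (1 + r t ω * δ) - 1)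

/-- The payout `∑_j ∑_{t=0}^T z_t^j (R(t₀^j, t₁^j) - F_t(t₀^j, t₁^j))` of entering, at each time
`t = 0, …, T`, the positions `z t` in the futures contracts. -/
noncomputable def payout (δ : ℝ) (F : ℕ → ℤ → Ω → ℝ) (r : ℕ → Ω → ℝ) (t₀ t₁ : Fin J → ℕ) (T : ℕ)
    (z : ℕ → Ω → Fin J → ℝ) (ω : Ω) : ℝ :=
  ∑ j, ∑ t ∈ Finset.range (T + 1),
    z t ω j * (sofrAverage δ r t₀ t₁ ω j - futuresRate δ F t₀ t₁ t ω j)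

/-- The futures market is arbitrage-free: every adapted strategy `z = (z_t)_{t=0}^T` that closes
all positions at time `T` and has an almost surely nonnegative payout has zero payout almost
surely. -/
def IsArbitrageFree {mΩ : MeasurableSpace Ω} (P : Measure Ω) (ℱ : Filtration ℕ mΩ) (δ : ℝ)
    (F : ℕ → ℤ → Ω → ℝ) (r : ℕ → Ω → ℝ) (t₀ t₁ : Fin J → ℕ) (T : ℕ) : Prop :=
  ∀ z : ℕ → Ω → Fin J → ℝ, (∀ t ≤ T, Measurable[ℱ t] (z t)) →
    (∀ᵐ ω ∂P, ∀ j, ∑ t ∈ Finset.range (T + 1), z t ω j = 0) →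
    (∀ᵐ ω ∂P, 0 ≤ payout δ F r t₀ t₁ T z ω) →
    ∀ᵐ ω ∂P, payout δ F r t₀ t₁ T z ω = 0

/-- The componentwise exponential. -/
noncomputable def vecExp (x : Fin J → ℝ) : Fin J → ℝ := fun j => Real.exp (x j)

end Market

end SofrFutures

/-!
The futures market is a market in assets with prices `X t = exp (G t)`. Since all positions are
closed at time `T`, the averages of the overnight rates cancel from the payout, and summation by
parts (`payout_eq_gains`) turns it into the gains `∑ θ t ⬝ᵥ (X (t + 1) - X t)` of the cumulated and
rescaled positions `θ`. The claim is then a form of the Dalang–Morton–Willinger theorem.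

Absence of arbitrage reduces to single periods (`isArbitrageFree_iff_onePeriod`): a strategy with
nonnegative gains must have nonnegative gains before its last period, for otherwise its last
position, taken only after a loss, would be an arbitrage (`gains_eq_zero_of_nonneg`).

For a single period let `κ` be a regular conditional distribution of `G (t + 1)` given `ℱ t`. The
conditional support is the topological support of `κ ω` (`ae_condSupport_eq_support`), so an
`ℱ t`-measurable position `θ` has nonnegative gains exactly when, for almost every `ω`, the
functional `θ ω` attains its minimum over the hull of the exponentials of the support and `X t ω`
at `X t ω`. If `X t ω` is in the relative interior of the hull, such a functional is constant there
(`eq_of_mem_intrinsicInterior`). If it is not, proper separation yields a functional that is not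
constant (`exists_separating_of_notMem_intrinsicInterior`). What remains is to choose this
functional measurably in `ω`. Let `C` be the closed convex cone generated by the possible net gains,
bounded by a positive rescaling, and let `u` be their mean, a relative interior point of `C`. There
is a nontrivial supporting functional if and only if `-u ∉ C`, and then the point of `u + C` closest
to the origin is one (`exists_measurable_supporting`). It is measurable in `ω` because `u + C` is
the closure of countably many measurable vectors (`exists_measurable_minNorm`).
-/

namespace SofrFutures

/-! ### Relative interiors and supporting functionals -/

section Convex

variable {E : Type*} [NormedAddCommGroup E] [NormedSpace ℝ E]

/-- A functional that attains its minimum over `C` at a relative interior point is constant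
on `C`. -/
theorem eq_of_mem_intrinsicInterior {C : Set E} {x : E} (hx : x ∈ intrinsicInterior ℝ C)
    (f : E →L[ℝ] ℝ) (hf : ∀ y ∈ C, f x ≤ f y) {y : E} (hy : y ∈ C) : f y = f x := by
  obtain ⟨a, ha, rfl⟩ := mem_intrinsicInterior.1 hx
  have hyA : y ∈ affineSpan ℝ C := subset_affineSpan _ _ hy
  -- the segment from `y` to `a` can be prolonged inside `C`
  let g : ℝ → affineSpan ℝ C := fun s =>
    ⟨AffineMap.lineMap y (a : E) s, AffineMap.lineMap_mem s hyA a.2⟩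
  have hg : Continuous g := by
    exact Continuous.subtype_mk AffineMap.lineMap_continuous _
  have hg1 : g 1 = a := Subtype.ext (by simp [g])
  have hev : ∀ᶠ s in 𝓝 (1 : ℝ), (g s : E) ∈ C := by
    have h1 : interior ((↑) ⁻¹' C : Set (affineSpan ℝ C)) ∈ 𝓝 (g 1) :=
      isOpen_interior.mem_nhds (hg1 ▸ ha)
    filter_upwards [hg.continuousAt.preimage_mem_nhds h1] with s hs
    exact interior_subset (s := ((↑) ⁻¹' C : Set (affineSpan ℝ C))) hs
  obtain ⟨s, hs, hs1⟩ := ((hev.filter_mono nhdsWithin_le_nhds).and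
    (self_mem_nhdsWithin : Ioi (1 : ℝ) ∈ 𝓝[>] 1)).exists
  have h2 := hf _ hs
  have h3 := hf _ hy
  simp only [g, AffineMap.lineMap_apply_module, map_add, map_smul, smul_eq_mul] at h2
  have hs1 : 1 < s := hs1
  nlinarith

/-- Proper separation of a convex set from a point outside its relative interior. -/
theorem exists_separating_of_notMem_intrinsicInterior [FiniteDimensional ℝ E] {C : Set E}
    (hC : Convex ℝ C) (hne : C.Nonempty) {x : E} (hx : x ∉ intrinsicInterior ℝ C) :
    ∃ f : E →L[ℝ] ℝ, (∀ y ∈ C, f x ≤ f y) ∧ ∃ y ∈ C, f x < f y := by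
  by_cases hxA : x ∈ affineSpan ℝ C
  · -- inside the affine span `C` has nonempty interior, which can be separated from `x`
    let a : affineSpan ℝ C := ⟨x, hxA⟩
    have : Nonempty (affineSpan ℝ C) := ⟨a⟩
    let e := (AffineIsometryEquiv.vaddConst ℝ a).toHomeomorph
    let C' : Set (affineSpan ℝ C).direction := e ⁻¹' ((↑) ⁻¹' C)
    have hmem : ∀ v : (affineSpan ℝ C).direction, v ∈ C' ↔ (v : E) + x ∈ C := fun v => Iff.rfl
    have hC' : Convex ℝ C' := by
      intro v hv w hw s t hs ht hst
      rw [hmem] at hv hw ⊢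
      convert hC hv hw hs ht hst using 1
      have : x = s • x + t • x := by rw [← add_smul, hst, one_smul]
      simp only [Submodule.coe_add, Submodule.coe_smul, smul_add]
      nth_rw 1 [this]
      abel
    have hint : interior C' = e ⁻¹' interior ((↑) ⁻¹' C) := (e.preimage_interior _).symm
    have hne' : (interior C').Nonempty := by
      obtain ⟨y, hy⟩ := hne.intrinsicInterior hC
      obtain ⟨b, hb, -⟩ := mem_intrinsicInterior.1 hy
      exact ⟨e.symm b, by rw [hint]; simpa using hb⟩
    have h0 : (0 : (affineSpan ℝ C).direction) ∉ interior C' := by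
      intro h
      rw [hint] at h
      refine hx (mem_intrinsicInterior.2 ⟨e 0, h, ?_⟩)
      simp [e, a]
    obtain ⟨f, hf⟩ := geometric_hahn_banach_open_point hC'.interior isOpen_interior h0
    obtain ⟨g, hg, -⟩ := exists_extension_norm_eq _ f
    have hle : ∀ v ∈ C', f v ≤ 0 := by
      intro v hv
      have hv' : v ∈ closure (interior C') := by
        rw [hC'.closure_interior_eq_closure_of_nonempty_interior hne']
        exact subset_closure hv
      refine closure_minimal (t := {v | f v ≤ 0}) ?_
        (isClosed_le f.continuous continuous_const) hv'
      intro w hw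
      simpa using (hf w hw).le
    have hdir : ∀ y ∈ C, ∃ v ∈ C', g y = g x + f v := by
      intro y hy
      refine ⟨⟨y - x, AffineSubspace.vsub_mem_direction (subset_affineSpan _ _ hy) hxA⟩, ?_, ?_⟩
      · rw [hmem]; simpa using hy
      · rw [← hg]; simp
    refine ⟨-g, fun y hy => ?_, ?_⟩
    · obtain ⟨v, hv, hvy⟩ := hdir y hy
      have := hle v hv
      simp only [neg_apply, hvy]
      linarith
    · obtain ⟨v, hv⟩ := hne'
      refine ⟨(v : E) + x, (hmem v).1 (interior_subset hv), ?_⟩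
      have := hf v hv
      simp only [neg_apply, map_add, hg]
      simp only [map_zero] at this
      linarith
  · obtain ⟨f, u, hfx, hf⟩ := geometric_hahn_banach_point_closed (affineSpan ℝ C).convex
      (AffineSubspace.closed_of_finiteDimensional _) hxA
    have h : ∀ y ∈ C, f x < f y := fun y hy => hfx.trans (hf y (subset_affineSpan _ _ hy))
    obtain ⟨y, hy⟩ := hne
    exact ⟨f, fun y hy => (h y hy).le, y, hy, h y hy⟩

end Convex

/-! ### Measurable selection of the point of minimal norm -/

section MinNorm

variable {E : Type*} [NormedAddCommGroup E] [InnerProductSpace ℝ E]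

local notation "⟪" x ", " y "⟫" => inner ℝ x y

/-- If the closure of a countable family of measurable vectors is convex at each `ω`, then its
point `θ ω` of minimal norm depends measurably on `ω`. -/
theorem exists_measurable_minNorm [CompleteSpace E] [MeasurableSpace E] [BorelSpace E]
    {Ω ι : Type*} {mΩ : MeasurableSpace Ω} [Countable ι] [Nonempty ι] (d : ι → Ω → E)
    (hd : ∀ i, Measurable (d i)) (hconv : ∀ ω, Convex ℝ (closure (range fun i => d i ω))) :
    ∃ θ : Ω → E, Measurable θ ∧ ∀ ω, θ ω ∈ closure (range fun i => d i ω) ∧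
      ∀ y ∈ closure (range fun i => d i ω), ‖θ ω‖ ^ 2 ≤ ⟪θ ω, y⟫ := by
  have hex : ∀ ω, ∃ v ∈ closure (range fun i => d i ω),
      ∀ y ∈ closure (range fun i => d i ω), ‖v‖ ^ 2 ≤ ⟪v, y⟫ := by
    intro ω
    obtain ⟨v, hv, hmin⟩ := exists_norm_eq_iInf_of_complete_convex
      ((range_nonempty fun i => d i ω).mono subset_closure) isClosed_closure.isComplete
      (hconv ω) 0
    refine ⟨v, hv, fun y hy => ?_⟩
    have := (norm_eq_iInf_iff_real_inner_le_zero (hconv ω) hv).1 hmin y hy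
    rw [zero_sub, inner_neg_left, inner_sub_right, real_inner_self_eq_norm_sq] at this
    linarith
  choose θ hθ hθmin using hex
  refine ⟨θ, ?_, fun ω => ⟨hθ ω, hθmin ω⟩⟩
  have hle : ∀ ω, ∀ y ∈ closure (range fun i => d i ω), ‖θ ω‖ ≤ ‖y‖ := by
    intro ω y hy
    have h1 := hθmin ω y hy
    have h2 := real_inner_le_norm (θ ω) y
    by_contra! h3
    nlinarith [norm_nonneg y]
  obtain ⟨e, he⟩ := exists_surjective_nat ι
  -- `θ` is the limit of the first points of the sequence that are nearly minimal
  let p : ℕ → ℕ → Ω → Prop := fun n k ω => ∀ j, ‖d (e k) ω‖ ≤ ‖d j ω‖ + 1 / ((n : ℝ) + 1)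
  have hpm : ∀ n k, MeasurableSet {ω | p n k ω} := by
    intro n k
    simp only [p, ofPred_forall]
    exact MeasurableSet.iInter fun j => measurableSet_le (hd _).norm ((hd j).norm.add_const _)
  have hp : ∀ n ω, ∃ k, p n k ω := by
    intro n ω
    have hpos : 0 < 1 / ((n : ℝ) + 1) := Nat.one_div_pos_of_nat
    obtain ⟨y, ⟨i, rfl⟩, hi⟩ := Metric.mem_closure_iff.1 (hθ ω) _ hpos
    obtain ⟨k, rfl⟩ := he i
    refine ⟨k, fun j => ?_⟩
    have h1 := hle ω _ (subset_closure ⟨j, rfl⟩)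
    have h2 : ‖d (e k) ω‖ ≤ ‖θ ω‖ + ‖θ ω - d (e k) ω‖ := by
      have := norm_sub_norm_le (d (e k) ω) (θ ω)
      rw [norm_sub_rev] at this
      linarith
    rw [dist_eq_norm] at hi
    linarith
  classical
  refine measurable_of_tendsto_metrizable
    (fun n => Measurable.find (f := fun k ω => d (e k) ω) (fun k => hd _) (hpm n) (hp n)) ?_
  rw [tendsto_pi_nhds]
  intro ω
  rw [tendsto_iff_norm_sub_tendsto_zero]
  have hlim : Tendsto (fun n : ℕ => Real.sqrt ((‖θ ω‖ + 1 / ((n : ℝ) + 1)) ^ 2 - ‖θ ω‖ ^ 2)) atTop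
      (𝓝 0) := by
    have h := tendsto_one_div_add_atTop_nhds_zero_nat (𝕜 := ℝ)
    have := (((h.const_add ‖θ ω‖).pow 2).sub_const (‖θ ω‖ ^ 2)).sqrt
    simpa using this
  refine squeeze_zero (fun _ => norm_nonneg _) (fun n => ?_) hlim
  refine Real.le_sqrt_of_sq_le ?_
  have hk := Nat.find_spec (hp n ω)
  set k := Nat.find (hp n ω)
  have h1 : ‖d (e k) ω‖ ≤ ‖θ ω‖ + 1 / ((n : ℝ) + 1) := by
    refine closure_minimal (t := {y | ‖d (e k) ω‖ ≤ ‖y‖ + 1 / ((n : ℝ) + 1)}) ?_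
      (isClosed_le continuous_const (by fun_prop)) (hθ ω)
    rintro _ ⟨j, rfl⟩
    exact hk j
  have h2 := hθmin ω _ (subset_closure ⟨e k, rfl⟩)
  have h3 := norm_sub_sq_real (d (e k) ω) (θ ω)
  rw [real_inner_comm] at h3
  have h4 : ‖d (e k) ω‖ ^ 2 ≤ (‖θ ω‖ + 1 / ((n : ℝ) + 1)) ^ 2 := by gcongr
  linarith

/-- The linear combination of the vectors `v i` with nonnegative rational coefficients `q i`. -/
noncomputable def nnratComb {ι : Type*} (v : ι → E) (q : ι →₀ ℚ≥0) : E :=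
  q.sum fun i c => (c : ℝ) • v i

theorem nnratComb_add {ι : Type*} (v : ι → E) (p q : ι →₀ ℚ≥0) :
    nnratComb v (p + q) = nnratComb v p + nnratComb v q :=
  Finsupp.sum_add_index' (by simp) (by intros; simp [add_smul])

theorem nnratComb_smul {ι : Type*} (v : ι → E) (c : ℚ≥0) (q : ι →₀ ℚ≥0) :
    nnratComb v (c • q) = (c : ℝ) • nnratComb v q := by
  rw [nnratComb, Finsupp.sum_smul_index (by simp), nnratComb, Finsupp.smul_sum]
  simp [mul_smul]

theorem nnratComb_single {ι : Type*} (v : ι → E) (i : ι) :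
    nnratComb v (Finsupp.single i 1) = v i := by
  simp [nnratComb]

theorem inner_nnratComb {ι : Type*} (v : ι → E) (q : ι →₀ ℚ≥0) (x : E) :
    ⟪x, nnratComb v q⟫ = q.sum fun i c => (c : ℝ) * ⟪x, v i⟫ := by
  simp [nnratComb, Finsupp.sum, inner_sum, inner_smul_right]

/-- The closure of the set of rational combinations is closed under addition and under
multiplication by nonnegative reals, so it is a convex cone. -/
theorem convex_closure_range_add_nnratComb {ι : Type*} (u : E) (v : ι → E) :
    Convex ℝ (closure (range fun q => u + nnratComb v q)) := by
  have hadd : ∀ x ∈ closure (range (nnratComb v)), ∀ y ∈ closure (range (nnratComb v)),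
      x + y ∈ closure (range (nnratComb v)) := by
    intro x hx y hy
    refine map_mem_closure₂ continuous_add hx hy ?_
    rintro _ ⟨p, rfl⟩ _ ⟨q, rfl⟩
    exact ⟨p + q, nnratComb_add v p q⟩
  have hsmul : ∀ c : ℝ, 0 ≤ c → ∀ x ∈ closure (range (nnratComb v)),
      c • x ∈ closure (range (nnratComb v)) := by
    intro c hc x hx
    have hc' : c ∈ closure (range ((↑) : ℚ≥0 → ℝ)) := by
      refine Metric.mem_closure_iff.2 fun ε hε => ?_
      obtain ⟨q, hcq, hqε⟩ := exists_rat_btwn (lt_add_of_pos_right c hε)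
      have hq : 0 ≤ q := by exact_mod_cast hc.trans hcq.le
      refine ⟨_, ⟨⟨q, hq⟩, rfl⟩, ?_⟩
      rw [dist_comm, Real.dist_eq]
      change |(q : ℝ) - c| < ε
      rw [abs_lt]
      constructor <;> linarith
    refine map_mem_closure₂ (f := fun (c : ℝ) (x : E) => c • x) (by fun_prop) hc' hx ?_
    rintro _ ⟨c, rfl⟩ _ ⟨q, rfl⟩
    exact ⟨c • q, nnratComb_smul v c q⟩
  have hconv : Convex ℝ (closure (range (nnratComb v))) := fun x hx y hy a b ha hb _ =>
    hadd _ (hsmul a ha x hx) _ (hsmul b hb y hy)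
  have : closure (range fun q => u + nnratComb v q)
      = (fun x => u + x) '' closure (range (nnratComb v)) := by
    rw [show (fun q => u + nnratComb v q) = (fun x => u + x) ∘ nnratComb v from rfl, range_comp]
    exact ((Homeomorph.addLeft u).image_closure _).symm
  rw [this]
  exact hconv.translate u

end MinNorm

/-! ### Measurable selection of a supporting functional -/

section Selection

variable {E : Type*} [NormedAddCommGroup E] [InnerProductSpace ℝ E]

local notation "⟪" x ", " y "⟫" => inner ℝ x y

/-- Some vector `θ ω` depending measurably on `ω` satisfies `⟪θ ω, ψ ω x⟫ ≥ 0` for `κ ω`-almost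
all `x`, and does so nontrivially whenever any vector `k` does.  It is the point of minimal norm in
`u + C`, where `u` is the `κ ω`-integral of `ψ ω` and `C` is the closed convex cone generated by the
integrals of `ψ ω` over basic open sets.  If `θ ω` is orthogonal to `ψ ω` almost everywhere, it is
orthogonal to `u + C`, hence zero, so `-u ∈ C`; then every `k` that is nonnegative on `C` has
`⟪k, u⟫ ≤ 0`. -/
theorem exists_measurable_supporting [CompleteSpace E] [MeasurableSpace E] [BorelSpace E]
    [SecondCountableTopology E] {Ω 𝓧 : Type*} {mΩ : MeasurableSpace Ω} [TopologicalSpace 𝓧]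
    [SecondCountableTopology 𝓧] [MeasurableSpace 𝓧] [BorelSpace 𝓧] (κ : Kernel Ω 𝓧)
    [IsFiniteKernel κ] (ψ : Ω → 𝓧 → E) (hψ : Measurable (Function.uncurry ψ))
    (hcont : ∀ ω, Continuous (ψ ω)) (hbdd : ∀ ω x, ‖ψ ω x‖ ≤ 1) :
    ∃ θ : Ω → E, Measurable θ ∧ ∀ ω, (∀ᵐ x ∂κ ω, 0 ≤ ⟪θ ω, ψ ω x⟫) ∧
      ((∀ᵐ x ∂κ ω, ⟪θ ω, ψ ω x⟫ = 0) →
        ∀ k : E, (∀ᵐ x ∂κ ω, 0 ≤ ⟪k, ψ ω x⟫) → ∀ᵐ x ∂κ ω, ⟪k, ψ ω x⟫ = 0) := by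
  let B : TopologicalSpace.countableBasis 𝓧 → Set 𝓧 := fun i => i
  have hbasis : TopologicalSpace.IsTopologicalBasis (range B) := by
    rw [Subtype.range_coe]
    exact TopologicalSpace.isBasis_countableBasis 𝓧
  have hBo : ∀ i, IsOpen (B i) := fun i => hbasis.isOpen ⟨i, rfl⟩
  have hBm : ∀ i, MeasurableSet (B i) := fun i => (hBo i).measurableSet
  have hint : ∀ ω, Integrable (ψ ω) (κ ω) := fun ω =>
    Integrable.of_bound (hcont ω).aestronglyMeasurable 1 (Eventually.of_forall (hbdd ω))
  let u : Ω → E := fun ω => ∫ x, ψ ω x ∂κ ω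
  let v : TopologicalSpace.countableBasis 𝓧 → Ω → E := fun i ω => ∫ x in B i, ψ ω x ∂κ ω
  have hu : Measurable u := hψ.stronglyMeasurable.integral_kernel_prod_right.measurable
  have hv : ∀ i, Measurable (v i) := by
    intro i
    have h : StronglyMeasurable (Function.uncurry fun ω => (B i).indicator (ψ ω)) := by
      have : (Function.uncurry fun ω => (B i).indicator (ψ ω))
          = (Prod.snd ⁻¹' B i).indicator (Function.uncurry ψ) := by
        ext ⟨ω, x⟩; rfl
      rw [this]
      exact (hψ.indicator (measurable_snd (hBm i))).stronglyMeasurable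
    have := h.integral_kernel_prod_right (κ := κ)
    simp only [integral_indicator (hBm i)] at this
    exact this.measurable
  have hinner_u : ∀ k ω, ⟪k, u ω⟫ = ∫ x, ⟪k, ψ ω x⟫ ∂κ ω := fun k ω =>
    (integral_inner (hint ω) k).symm
  have hinner_v : ∀ k i ω, ⟪k, v i ω⟫ = ∫ x in B i, ⟪k, ψ ω x⟫ ∂κ ω := fun k i ω =>
    (integral_inner (hint ω).integrableOn k).symm
  have hinner_int : ∀ k ω, Integrable (fun x => ⟪k, ψ ω x⟫) (κ ω) := fun k ω =>
    (hint ω).const_inner k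
  let d : (TopologicalSpace.countableBasis 𝓧 →₀ ℚ≥0) → Ω → E := fun q ω =>
    u ω + nnratComb (fun i => v i ω) q
  have hd : ∀ q, Measurable (d q) := by
    intro q
    refine hu.add ?_
    simp only [nnratComb, Finsupp.sum]
    exact Finset.measurable_sum _ fun i _ => (hv i).const_smul _
  -- the values of `d` are dense in `u + C`
  obtain ⟨θ, hθm, hθ⟩ := exists_measurable_minNorm d hd fun ω =>
    convex_closure_range_add_nnratComb (u ω) fun i => v i ω
  refine ⟨θ, hθm, fun ω => ?_⟩
  obtain ⟨hθmem, hθmin⟩ := hθ ω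
  refine ⟨?_, fun h0 k hk => ?_⟩
  · -- adding multiples of `v i` to a point of `range d` cannot lower the inner product with `θ`
    have hpos : ∀ i, 0 ≤ ⟪θ ω, v i ω⟫ := by
      intro i
      by_contra! hneg
      obtain ⟨n, hn⟩ := exists_nat_gt (⟪θ ω, u ω⟫ / -⟪θ ω, v i ω⟫)
      rw [div_lt_iff₀ (by linarith)] at hn
      have := hθmin _ (subset_closure ⟨(n : ℚ≥0) • Finsupp.single i 1, rfl⟩)
      simp only [d, nnratComb_smul, nnratComb_single, inner_add_right, inner_smul_right,
        NNRat.cast_natCast] at this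
      nlinarith [sq_nonneg ‖θ ω‖]
    have hnull : κ ω {x | ⟪θ ω, ψ ω x⟫ < 0} = 0 := by
      have hopen : IsOpen {x | ⟪θ ω, ψ ω x⟫ < 0} :=
        isOpen_lt (continuous_const.inner (hcont ω)) continuous_const
      obtain ⟨I, hI⟩ : ∃ I : Set (TopologicalSpace.countableBasis 𝓧),
          {x | ⟪θ ω, ψ ω x⟫ < 0} = ⋃ i ∈ I, B i := by
        refine ⟨{i | B i ⊆ {x | ⟪θ ω, ψ ω x⟫ < 0}}, Subset.antisymm (fun x hx => ?_)
          (iUnion₂_subset fun i hi => hi)⟩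
        obtain ⟨_, ⟨i, rfl⟩, hxi, hi⟩ := hbasis.exists_subset_of_mem_open hx hopen
        exact mem_biUnion hi hxi
      rw [hI, measure_biUnion_null_iff I.to_countable]
      intro i hi
      have hsub : ∀ x ∈ B i, ⟪θ ω, ψ ω x⟫ < 0 := fun x hx =>
        hI.symm.subset (mem_biUnion hi hx)
      by_contra hne
      have hlt : 0 < ∫ x in B i, -⟪θ ω, ψ ω x⟫ ∂κ ω := by
        rw [setIntegral_pos_iff_support_of_nonneg_ae]
        · have : Function.support (fun x => -⟪θ ω, ψ ω x⟫) ∩ B i = B i :=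
            inter_eq_right.2 fun x hx => by simpa using (hsub x hx).ne
          rw [this]
          exact pos_iff_ne_zero.2 hne
        · filter_upwards [ae_restrict_mem (hBm i)] with x hx
          simpa using (hsub x hx).le
        · exact (hinner_int _ _).neg.integrableOn
      rw [integral_neg, ← hinner_v] at hlt
      linarith [hpos i]
    filter_upwards [measure_eq_zero_iff_ae_notMem.1 hnull] with x hx
    simpa using hx
  · -- `θ` is orthogonal to a closed set that contains it, so it vanishes
    have hθ0 : θ ω = 0 := by
      have h1 : ∀ y ∈ closure (range fun q => d q ω), ⟪θ ω, y⟫ = 0 := by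
        intro y hy
        refine closure_minimal (t := {y | ⟪θ ω, y⟫ = 0}) ?_
          (isClosed_eq (by fun_prop) continuous_const) hy
        rintro _ ⟨q, rfl⟩
        have h2 : ∀ i, ⟪θ ω, v i ω⟫ = 0 := fun i => by
          rw [hinner_v, integral_eq_zero_of_ae (ae_restrict_of_ae h0)]
        have h3 : ⟪θ ω, u ω⟫ = 0 := by rw [hinner_u, integral_eq_zero_of_ae h0]
        simp [d, inner_add_right, inner_nnratComb, h2, h3, Finsupp.sum]
      simpa using h1 _ hθmem
    have hle : ⟪k, u ω⟫ ≤ 0 := by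
      have : ⟪k, u ω⟫ ≤ ⟪k, θ ω⟫ := by
        refine closure_minimal (t := {y | ⟪k, u ω⟫ ≤ ⟪k, y⟫}) ?_
          (isClosed_le continuous_const (by fun_prop)) hθmem
        rintro _ ⟨q, rfl⟩
        have h2 : ∀ i, 0 ≤ ⟪k, v i ω⟫ := fun i => by
          rw [hinner_v]
          exact integral_nonneg_of_ae (ae_restrict_of_ae hk)
        have h3 : 0 ≤ q.sum fun i c => (c : ℝ) * ⟪k, v i ω⟫ :=
          Finset.sum_nonneg fun i _ => mul_nonneg (by positivity) (h2 i)
        simpa [d, inner_add_right, inner_nnratComb] using h3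
      simpa [hθ0] using this
    rw [hinner_u] at hle
    exact (integral_eq_zero_iff_of_nonneg_ae hk (hinner_int k ω)).1
      (hle.antisymm (integral_nonneg_of_ae hk))

end Selection

/-! ### Conditional supports and regular conditional distributions -/

section Kernel

variable {Ω : Type*} {d : ℕ}

/-- A closed-valued measurable mapping has a measurable graph: `x ∉ S ω` if and only if some basic
open set contains `x` and misses `S ω`. -/
theorem MeasurableMapping.measurableSet_graph {m : MeasurableSpace Ω} {S : Ω → Set (Fin d → ℝ)}
    (hS : MeasurableMapping m S) (hc : ∀ ω, IsClosed (S ω)) :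
    MeasurableSet {p : Ω × (Fin d → ℝ) | p.2 ∈ S p.1} := by
  have hB := TopologicalSpace.isBasis_countableBasis (Fin d → ℝ)
  have : {p : Ω × (Fin d → ℝ) | p.2 ∈ S p.1} =
      (⋃ U ∈ TopologicalSpace.countableBasis (Fin d → ℝ), {ω | (S ω ∩ U).Nonempty}ᶜ ×ˢ U)ᶜ := by
    refine compl_injective ?_
    rw [compl_compl]
    ext ⟨ω, x⟩
    simp only [mem_compl_iff, mem_ofPred_eq, mem_iUnion, mem_prod, exists_prop]
    constructor
    · intro hx
      obtain ⟨U, hU, hxU, hUS⟩ := hB.exists_subset_of_mem_open hx (hc ω).isOpen_compl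
      exact ⟨U, hU, fun ⟨y, hyS, hyU⟩ => hUS hyU hyS, hxU⟩
    · rintro ⟨U, -, hU, hxU⟩ hx
      exact hU ⟨x, hx, hxU⟩
  rw [this]
  refine (MeasurableSet.biUnion (TopologicalSpace.countable_countableBasis _) fun U hU => ?_).compl
  exact (hS U (hB.isOpen hU)).compl.prod (hB.isOpen hU).measurableSet

theorem measurableMapping_support {m : MeasurableSpace Ω} (κ : Kernel Ω (Fin d → ℝ)) :
    MeasurableMapping m fun ω => (κ ω).support := by
  intro U hU
  have : {ω | ((κ ω).support ∩ U).Nonempty} = {ω | κ ω U = 0}ᶜ := by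
    ext ω
    refine ⟨fun ⟨x, hx, hxU⟩ => ?_, fun h => ?_⟩
    · exact ((Measure.mem_support_iff_forall x).1 hx U (hU.mem_nhds hxU)).ne'
    · rw [mem_ofPred_eq, inter_comm]
      exact Measure.nonempty_inter_support_of_pos (pos_iff_ne_zero.2 h)
  rw [this]
  exact (κ.measurable_coe hU.measurableSet (measurableSet_singleton 0)).compl

theorem ae_condDistrib_iff {Ω' : Type*} {mΩ : MeasurableSpace Ω} {mΩ' : MeasurableSpace Ω'}
    (P : Measure Ω) [IsFiniteMeasure P] {X : Ω → Fin d → ℝ} (hX : Measurable X) {f : Ω → Ω'}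
    (hf : Measurable f) {A : Set (Ω' × (Fin d → ℝ))} (hA : MeasurableSet A) :
    (∀ᵐ ω ∂P, (f ω, X ω) ∈ A) ↔ ∀ᵐ ω ∂P, ∀ᵐ x ∂condDistrib X f P (f ω), (f ω, x) ∈ A := by
  rw [← ae_map_iff (hf.prodMk hX).aemeasurable hA (p := fun p => p ∈ A),
    ← compProd_map_condDistrib hX.aemeasurable, Measure.ae_compProd_iff (p := fun p => p ∈ A) hA]
  refine ae_map_iff hf.aemeasurable (p := fun ω => ∀ᵐ x ∂condDistrib X f P ω, (ω, x) ∈ A) ?_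
  exact Kernel.measurable_kernel_prodMk_left hA.compl (measurableSet_singleton 0)

/-- A regular conditional distribution `κ` of `X` given `m`, characterized by its action on null
sets. -/
theorem exists_kernel_ae_iff {m mΩ : MeasurableSpace Ω} (hm : m ≤ mΩ) (P : Measure Ω)
    [IsProbabilityMeasure P] {X : Ω → Fin d → ℝ} (hX : Measurable X) :
    ∃ κ : @Kernel Ω (Fin d → ℝ) m _, @IsMarkovKernel Ω (Fin d → ℝ) m _ κ ∧
      ∀ A : Set (Ω × (Fin d → ℝ)), MeasurableSet[m.prod inferInstance] A →
        ((∀ᵐ ω ∂P, (ω, X ω) ∈ A) ↔ ∀ᵐ ω ∂P, ∀ᵐ x ∂κ ω, (ω, x) ∈ A) := by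
  have hid : @Measurable Ω Ω mΩ m id := measurable_id'' hm
  exact ⟨@condDistrib Ω Ω (Fin d → ℝ) _ _ _ mΩ m X id P _, inferInstance, fun A hA =>
    @ae_condDistrib_iff Ω d Ω mΩ m P _ X hX id hid A hA⟩

/-- The conditional support is the topological support of the conditional distribution. -/
theorem ae_condSupport_eq_support {m mΩ : MeasurableSpace Ω} (hm : m ≤ mΩ) (P : Measure Ω)
    [IsProbabilityMeasure P] {X : Ω → Fin d → ℝ} (hX : Measurable X)
    (κ : @Kernel Ω (Fin d → ℝ) m _)
    (hκ : ∀ A : Set (Ω × (Fin d → ℝ)), MeasurableSet[m.prod inferInstance] A →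
        ((∀ᵐ ω ∂P, (ω, X ω) ∈ A) ↔ ∀ᵐ ω ∂P, ∀ᵐ x ∂κ ω, (ω, x) ∈ A)) :
    ∀ᵐ ω ∂P, condSupport m P X ω = (κ ω).support := by
  have hS := isCondSupport_condSupport hm P hX
  have h1 : ∀ᵐ ω ∂P, X ω ∈ (κ ω).support :=
    (hκ _ ((measurableMapping_support κ).measurableSet_graph
      fun _ => Measure.isClosed_support)).2 (ae_of_all _ fun ω => Measure.support_mem_ae)
  have h2 := (hκ _ (hS.measurable.measurableSet_graph hS.isClosed)).1 hS.mem
  filter_upwards [hS.le _ (fun _ => Measure.isClosed_support) (measurableMapping_support κ) h1, h2]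
    with ω hle hω
  exact hle.antisymm (Measure.support_subset_of_isClosed (hS.isClosed ω) hω)

end Kernel

/-! ### The one-period market -/

section OnePeriod

variable {Ω : Type*} {d : ℕ}

theorem measurable_dotProduct_sub {𝓧 : Type*} {mΩ : MeasurableSpace Ω} {mX : MeasurableSpace 𝓧}
    {θ x : Ω → Fin d → ℝ} {φ : 𝓧 → Fin d → ℝ} (hθ : Measurable θ) (hx : Measurable x)
    (hφ : Measurable φ) : Measurable fun p : Ω × 𝓧 => θ p.1 ⬝ᵥ (φ p.2 - x p.1) := by
  simp only [dotProduct]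
  refine Finset.measurable_sum _ fun j _ => ?_
  have h1 : Measurable fun p : Ω × 𝓧 => θ p.1 j :=
    (measurable_pi_apply j).comp (hθ.comp measurable_fst)
  have h2 : Measurable fun p : Ω × 𝓧 => φ p.2 j :=
    (measurable_pi_apply j).comp (hφ.comp measurable_snd)
  have h3 : Measurable fun p : Ω × 𝓧 => x p.1 j :=
    (measurable_pi_apply j).comp (hx.comp measurable_fst)
  exact h1.mul (h2.sub h3)

theorem exists_dotProduct_eq (f : (Fin d → ℝ) →L[ℝ] ℝ) :
    ∃ k : Fin d → ℝ, ∀ y, f y = k ⬝ᵥ y := by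
  refine ⟨fun j => f (Pi.single j 1), fun y => ?_⟩
  have := f.toLinearMap.pi_apply_eq_sum_univ y
  simp only [ContinuousLinearMap.coe_coe, smul_eq_mul] at this
  rw [this, dotProduct]
  refine Finset.sum_congr rfl fun j _ => ?_
  rw [mul_comm]
  congr 2
  ext i
  simp [Pi.single_apply, eq_comm]

theorem exists_measurable_supporting_dotProduct {mΩ : MeasurableSpace Ω}
    (κ : Kernel Ω (Fin d → ℝ)) [IsFiniteKernel κ] {φ : (Fin d → ℝ) → Fin d → ℝ}
    (hφ : Continuous φ) {x : Ω → Fin d → ℝ} (hx : Measurable x) :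
    ∃ θ : Ω → Fin d → ℝ, Measurable θ ∧ ∀ ω, (∀ᵐ g ∂κ ω, 0 ≤ θ ω ⬝ᵥ (φ g - x ω)) ∧
      ((∀ᵐ g ∂κ ω, θ ω ⬝ᵥ (φ g - x ω) = 0) →
        ∀ k : Fin d → ℝ, (∀ᵐ g ∂κ ω, 0 ≤ k ⬝ᵥ (φ g - x ω)) →
          ∀ᵐ g ∂κ ω, k ⬝ᵥ (φ g - x ω) = 0) := by
  -- the factor `c` makes the net gains bounded without changing the signs of inner products
  let η : Ω → (Fin d → ℝ) → EuclideanSpace ℝ (Fin d) := fun ω g => WithLp.toLp 2 (φ g - x ω)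
  let c : Ω → (Fin d → ℝ) → ℝ := fun ω g => (1 + ‖η ω g‖)⁻¹
  have hc : ∀ ω g, 0 < c ω g := fun ω g => by positivity
  have hηm : Measurable (Function.uncurry η) := by
    refine (PiLp.continuous_toLp 2 _).measurable.comp ?_
    exact (hφ.measurable.comp measurable_snd).sub (hx.comp measurable_fst)
  have hηc : ∀ ω, Continuous (η ω) := fun ω =>
    (PiLp.continuous_toLp 2 _).comp (hφ.sub continuous_const)
  obtain ⟨θ, hθm, hθ⟩ := exists_measurable_supporting κ (fun ω g => c ω g • η ω g)
    ((hηm.norm.const_add 1).inv.smul hηm)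
    (fun ω => ((continuous_const.add (hηc ω).norm).inv₀ fun g =>
      (add_pos_of_pos_of_nonneg one_pos (norm_nonneg _)).ne').smul (hηc ω))
    (fun ω g => by
      rw [norm_smul, Real.norm_of_nonneg (hc ω g).le, inv_mul_le_iff₀ (by positivity)]
      linarith)
  have hinner : ∀ (k : EuclideanSpace ℝ (Fin d)) ω g,
      inner ℝ k (c ω g • η ω g) = c ω g * (k.ofLp ⬝ᵥ (φ g - x ω)) := by
    intro k ω g
    rw [inner_smul_right, EuclideanSpace.inner_eq_star_dotProduct, dotProduct_comm]
    simp [η]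
  simp only [hinner, mul_nonneg_iff_of_pos_left (hc _ _), mul_eq_zero, (hc _ _).ne', false_or]
    at hθ
  exact ⟨fun ω => (θ ω).ofLp, (PiLp.continuous_ofLp 2 _).measurable.comp hθm, fun ω =>
    ⟨(hθ ω).1, fun h k => (hθ ω).2 h (WithLp.toLp 2 k)⟩⟩

/-- Absence of arbitrage over one period, for current prices `x` and future prices `φ X`. -/
theorem onePeriod_iff {m mΩ : MeasurableSpace Ω} (hm : m ≤ mΩ) (P : Measure Ω)
    [IsProbabilityMeasure P] {X : Ω → Fin d → ℝ} (hX : Measurable X)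
    {φ : (Fin d → ℝ) → Fin d → ℝ} (hφ : Continuous φ) {x : Ω → Fin d → ℝ}
    (hx : Measurable[m] x) :
    (∀ θ : Ω → Fin d → ℝ, Measurable[m] θ → (∀ᵐ ω ∂P, 0 ≤ θ ω ⬝ᵥ (φ (X ω) - x ω)) →
        ∀ᵐ ω ∂P, θ ω ⬝ᵥ (φ (X ω) - x ω) = 0) ↔
      ∀ᵐ ω ∂P, x ω ∈ intrinsicInterior ℝ (convexHull ℝ (φ '' condSupport m P X ω)) := by
  obtain ⟨κ, hκM, hκ⟩ := exists_kernel_ae_iff hm P hX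
  have hsupp := ae_condSupport_eq_support hm P hX κ hκ
  have hnonneg : ∀ θ : Ω → Fin d → ℝ, Measurable[m] θ →
      ((∀ᵐ ω ∂P, 0 ≤ θ ω ⬝ᵥ (φ (X ω) - x ω)) ↔
        ∀ᵐ ω ∂P, ∀ᵐ g ∂κ ω, 0 ≤ θ ω ⬝ᵥ (φ g - x ω)) := fun θ hθ =>
    hκ {p | 0 ≤ θ p.1 ⬝ᵥ (φ p.2 - x p.1)}
      (measurableSet_le measurable_const (measurable_dotProduct_sub hθ hx hφ.measurable))
  have hzero : ∀ θ : Ω → Fin d → ℝ, Measurable[m] θ →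
      ((∀ᵐ ω ∂P, θ ω ⬝ᵥ (φ (X ω) - x ω) = 0) ↔
        ∀ᵐ ω ∂P, ∀ᵐ g ∂κ ω, θ ω ⬝ᵥ (φ g - x ω) = 0) := fun θ hθ =>
    hκ {p | θ p.1 ⬝ᵥ (φ p.2 - x p.1) = 0}
      ((measurable_dotProduct_sub hθ hx hφ.measurable) (measurableSet_singleton 0))
  have hcont : ∀ (k : Fin d → ℝ) (ω : Ω), Continuous fun g => k ⬝ᵥ (φ g - x ω) := fun k ω =>
    continuous_const.dotProduct (hφ.sub continuous_const)
  constructor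
  · intro hNA
    obtain ⟨θ, hθm, hθ⟩ := exists_measurable_supporting_dotProduct κ hφ hx
    have h0 := (hzero θ hθm).1
      (hNA θ hθm ((hnonneg θ hθm).2 (ae_of_all _ fun ω => (hθ ω).1)))
    filter_upwards [hsupp, h0] with ω hS h0ω
    rw [hS]
    by_contra hri
    have hne : (φ '' (κ ω).support).Nonempty :=
      ((Measure.nonempty_support (NeZero.ne (κ ω)))).image φ
    obtain ⟨f, hf, y, hy, hfy⟩ := exists_separating_of_notMem_intrinsicInterior
      (convex_convexHull ℝ _) (hne.mono (subset_convexHull ℝ _)) hri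
    obtain ⟨k, hk⟩ := exists_dotProduct_eq f
    have hk0 : ∀ᵐ g ∂κ ω, 0 ≤ k ⬝ᵥ (φ g - x ω) := by
      filter_upwards [Measure.support_mem_ae (μ := κ ω)] with g hg
      rw [← hk, map_sub, sub_nonneg]
      exact hf _ (subset_convexHull ℝ _ (mem_image_of_mem φ hg))
    have hk1 : (κ ω).support ⊆ {g | k ⬝ᵥ (φ g - x ω) = 0} :=
      Measure.support_subset_of_isClosed (isClosed_eq (hcont k ω) continuous_const)
        ((hθ ω).2 h0ω k hk0)
    have hsub : convexHull ℝ (φ '' (κ ω).support) ⊆ {y | f y = f (x ω)} := by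
      refine convexHull_min ?_ (convex_hyperplane f.isLinear _)
      rintro _ ⟨g, hg, rfl⟩
      have : f (φ g - x ω) = 0 := by rw [hk]; exact hk1 hg
      rwa [map_sub, sub_eq_zero] at this
    exact hfy.ne' (hsub hy)
  · intro hri θ hθm hpos
    rw [hzero θ hθm]
    filter_upwards [hsupp, hri, (hnonneg θ hθm).1 hpos] with ω hS hriω hposω
    rw [hS] at hriω
    let f : (Fin d → ℝ) →L[ℝ] ℝ := LinearMap.toContinuousLinearMap (dotProductBilin ℝ ℝ (θ ω))
    have hf : ∀ y, f (y - x ω) = θ ω ⬝ᵥ (y - x ω) := fun y => rfl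
    have h1 : (κ ω).support ⊆ {g | 0 ≤ θ ω ⬝ᵥ (φ g - x ω)} :=
      Measure.support_subset_of_isClosed (isClosed_le continuous_const (hcont _ ω)) hposω
    have h2 : convexHull ℝ (φ '' (κ ω).support) ⊆ {y | f (x ω) ≤ f y} := by
      refine convexHull_min ?_ (convex_halfSpace_ge f.isLinear _)
      rintro _ ⟨g, hg, rfl⟩
      have : 0 ≤ f (φ g - x ω) := by rw [hf]; exact h1 hg
      rwa [map_sub, sub_nonneg] at this
    filter_upwards [Measure.support_mem_ae (μ := κ ω)] with g hg
    rw [← hf, map_sub, sub_eq_zero]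
    exact eq_of_mem_intrinsicInterior hriω f (fun y hy => h2 hy)
      (subset_convexHull ℝ _ (mem_image_of_mem φ hg))

end OnePeriod

/-! ### The multi-period market -/

section MultiPeriod

variable {Ω : Type*} {J : ℕ}

/-- The gains up to time `n` from holding `θ t` units of assets with prices `X` during the period
from `t` to `t + 1`. -/
def gains (X θ : ℕ → Ω → Fin J → ℝ) (n : ℕ) (ω : Ω) : ℝ :=
  ∑ t ∈ Finset.range n, θ t ω ⬝ᵥ (X (t + 1) ω - X t ω)

theorem gains_succ (X θ : ℕ → Ω → Fin J → ℝ) (n : ℕ) (ω : Ω) :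
    gains X θ (n + 1) ω = gains X θ n ω + θ n ω ⬝ᵥ (X (n + 1) ω - X n ω) :=
  Finset.sum_range_succ _ _

theorem measurable_gains {mΩ : MeasurableSpace Ω} {ℱ : Filtration ℕ mΩ}
    {X θ : ℕ → Ω → Fin J → ℝ} {n : ℕ} (hX : ∀ t ≤ n, Measurable[ℱ t] (X t))
    (hθ : ∀ t < n, Measurable[ℱ t] (θ t)) : Measurable[ℱ n] (gains X θ n) := by
  change Measurable[ℱ n] fun ω => ∑ t ∈ Finset.range n, ∑ j, θ t ω j * (X (t + 1) ω j - X t ω j)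
  refine Finset.measurable_sum _ fun t ht => Finset.measurable_sum _ fun j _ => ?_
  have ht := Finset.mem_range.1 ht
  have h : ∀ {s} {Y : Ω → Fin J → ℝ}, s ≤ n → Measurable[ℱ s] Y →
      Measurable[ℱ n] fun ω => Y ω j := fun hs hY =>
    (measurable_pi_apply j).comp (hY.mono (ℱ.mono hs) le_rfl)
  exact (h ht.le (hθ t ht)).mul ((h ht (hX _ ht)).sub (h ht.le (hX t ht.le)))

/-- Absence of arbitrage in each single period excludes it over several periods: on the event that
the gains before the last period are negative, the last position alone would be an arbitrage, so
those gains are nonnegative and vanish by induction. -/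
theorem gains_eq_zero_of_nonneg {mΩ : MeasurableSpace Ω} {P : Measure Ω} {ℱ : Filtration ℕ mΩ}
    {T : ℕ} {X : ℕ → Ω → Fin J → ℝ} (hX : ∀ t ≤ T, Measurable[ℱ t] (X t))
    (hNA : ∀ t < T, ∀ θ : Ω → Fin J → ℝ, Measurable[ℱ t] θ →
      (∀ᵐ ω ∂P, 0 ≤ θ ω ⬝ᵥ (X (t + 1) ω - X t ω)) →
        ∀ᵐ ω ∂P, θ ω ⬝ᵥ (X (t + 1) ω - X t ω) = 0)
    {n : ℕ} (hn : n ≤ T) {θ : ℕ → Ω → Fin J → ℝ} (hθ : ∀ t < n, Measurable[ℱ t] (θ t))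
    (hpos : ∀ᵐ ω ∂P, 0 ≤ gains X θ n ω) : ∀ᵐ ω ∂P, gains X θ n ω = 0 := by
  induction n with
  | zero => simp [gains]
  | succ n ih =>
    simp only [gains_succ] at hpos ⊢
    have hθ' : ∀ t < n, Measurable[ℱ t] (θ t) := fun t ht => hθ t (ht.trans n.lt_succ_self)
    have hgm := measurable_gains (fun t ht => hX t (ht.trans (n.le_succ.trans hn))) hθ'
    have hneg : MeasurableSet[ℱ n] {ω | gains X θ n ω < 0} := measurableSet_lt hgm measurable_const
    -- holding the position `θ n` only after a loss would be an arbitrage in the last period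
    have h0 := hNA n hn ({ω | gains X θ n ω < 0}.indicator (θ n))
      ((hθ n n.lt_succ_self).indicator hneg) (by
        filter_upwards [hpos] with ω hω
        by_cases h : gains X θ n ω < 0
        · rw [indicator_of_mem (show ω ∈ {ω | gains X θ n ω < 0} from h)]
          linarith
        · rw [indicator_of_notMem (show ω ∉ {ω | gains X θ n ω < 0} from h), zero_dotProduct])
    have hn0 := ih (n.le_succ.trans hn) hθ' (by
      filter_upwards [hpos, h0] with ω hω h0ω
      by_contra! h
      rw [indicator_of_mem (show ω ∈ {ω | gains X θ n ω < 0} from h)] at h0ω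
      linarith)
    have hlast := hNA n hn (θ n) (hθ n n.lt_succ_self) (by
      filter_upwards [hpos, hn0] with ω hω h0ω
      linarith)
    filter_upwards [hn0, hlast] with ω h1 h2
    rw [h1, h2, add_zero]

end MultiPeriod

/-! ### The payout of a futures strategy -/

section Payout

variable {Ω : Type*} {J : ℕ}

/-- Summation by parts. -/
theorem sum_mul_eq_sub_sum_mul_sub (a x : ℕ → ℝ) (T : ℕ) :
    ∑ t ∈ Finset.range (T + 1), a t * x t = (∑ t ∈ Finset.range (T + 1), a t) * x T -
      ∑ t ∈ Finset.range T, (∑ s ∈ Finset.range (t + 1), a s) * (x (t + 1) - x t) := by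
  induction T with
  | zero => simp
  | succ T ih =>
    rw [Finset.sum_range_succ, ih, Finset.sum_range_succ (fun t => _ * _) T,
      Finset.sum_range_succ a (T + 1)]
    ring

/-- Positions in the futures, closed at time `T`, pay as much as trading assets with prices
`exp (G t)`: the averages of the overnight rates cancel, and summation by parts turns the positions
entered into the positions held. -/
theorem payout_eq_gains (δ : ℝ) (F : ℕ → ℤ → Ω → ℝ) (r : ℕ → Ω → ℝ) (t₀ t₁ : Fin J → ℕ) (T : ℕ)
    (z : ℕ → Ω → Fin J → ℝ) {ω : Ω} (hz : ∀ j, ∑ t ∈ Finset.range (T + 1), z t ω j = 0) :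
    payout δ F r t₀ t₁ T z ω = gains (fun t ω => vecExp (logGrowth δ F t₀ t₁ t ω))
      (fun t ω j => 1 / (((t₁ j : ℝ) - t₀ j) * δ) * ∑ s ∈ Finset.range (t + 1), z s ω j) T ω := by
  simp only [payout, gains, dotProduct, Pi.sub_apply]
  rw [Finset.sum_comm (s := Finset.range T)]
  refine Finset.sum_congr rfl fun j _ => ?_
  have h1 := sum_mul_eq_sub_sum_mul_sub (fun t => z t ω j)
    (fun t => vecExp (logGrowth δ F t₀ t₁ t ω) j) T
  simp only [hz j, zero_mul, zero_sub] at h1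
  set c := 1 / (((t₁ j : ℝ) - t₀ j) * δ)
  have h2 : ∀ t, futuresRate δ F t₀ t₁ t ω j
      = c * (vecExp (logGrowth δ F t₀ t₁ t ω) j - 1) := fun t => rfl
  calc ∑ t ∈ Finset.range (T + 1),
        z t ω j * (sofrAverage δ r t₀ t₁ ω j - futuresRate δ F t₀ t₁ t ω j)
      = (sofrAverage δ r t₀ t₁ ω j + c) * ∑ t ∈ Finset.range (T + 1), z t ω j
        - c * ∑ t ∈ Finset.range (T + 1), z t ω j * vecExp (logGrowth δ F t₀ t₁ t ω) j := by
        rw [Finset.mul_sum, Finset.mul_sum, ← Finset.sum_sub_distrib]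
        refine Finset.sum_congr rfl fun t _ => ?_
        rw [h2]
        ring
    _ = _ := by
        rw [hz j, h1, mul_zero, zero_sub, mul_neg, neg_neg, Finset.mul_sum]
        simp only [mul_assoc]

theorem measurable_logGrowth {mΩ : MeasurableSpace Ω} {δ : ℝ} {F : ℕ → ℤ → Ω → ℝ}
    {t₀ t₁ : Fin J → ℕ} {t : ℕ} (hF : ∀ s, Measurable (F t s)) :
    Measurable (logGrowth δ F t₀ t₁ t) :=
  measurable_pi_lambda _ fun _ => Finset.measurable_sum _ fun s _ => (hF s).mul_const δ

theorem continuous_vecExp : Continuous (vecExp : (Fin J → ℝ) → Fin J → ℝ) :=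
  continuous_pi fun j => Real.continuous_exp.comp (continuous_apply j)

theorem isArbitrageFree_iff_onePeriod {mΩ : MeasurableSpace Ω} {P : Measure Ω}
    {ℱ : Filtration ℕ mΩ} {δ : ℝ} (hδ : 0 < δ) {T : ℕ} {t₀ t₁ : Fin J → ℕ}
    (ht : ∀ j, t₀ j < t₁ j) {F : ℕ → ℤ → Ω → ℝ} (hF : ∀ t ≤ T, ∀ s, Measurable[ℱ t] (F t s))
    (r : ℕ → Ω → ℝ) :
    IsArbitrageFree P ℱ δ F r t₀ t₁ T ↔
      ∀ t < T, ∀ θ : Ω → Fin J → ℝ, Measurable[ℱ t] θ →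
        (∀ᵐ ω ∂P, 0 ≤ θ ω ⬝ᵥ
          (vecExp (logGrowth δ F t₀ t₁ (t + 1) ω) - vecExp (logGrowth δ F t₀ t₁ t ω))) →
        ∀ᵐ ω ∂P, θ ω ⬝ᵥ
          (vecExp (logGrowth δ F t₀ t₁ (t + 1) ω) - vecExp (logGrowth δ F t₀ t₁ t ω)) = 0 := by
  constructor
  · intro hNA t htT θ hθ hpos
    -- the position is entered at time `t` and closed at time `t + 1`
    let z : ℕ → Ω → Fin J → ℝ := fun s ω j =>
      ((if s = t then 1 else 0) - (if s = t + 1 then 1 else 0)) *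
        ((((t₁ j : ℝ) - t₀ j) * δ) * θ ω j)
    have hsum : ∀ n ω j, ∑ s ∈ Finset.range (n + 1), z s ω j
        = if n = t then (((t₁ j : ℝ) - t₀ j) * δ) * θ ω j else 0 := by
      intro n ω j
      simp only [z, ← Finset.sum_mul, Finset.sum_sub_distrib, Finset.sum_ite_eq',
        Finset.mem_range]
      rcases lt_trichotomy n t with h | h | h
      · simp [h.ne, show ¬ t < n + 1 by omega, show ¬ t < n by omega]
      · simp [h]
      · simp [h.ne', show t < n + 1 by omega, h]
    have hz0 : ∀ ω j, ∑ s ∈ Finset.range (T + 1), z s ω j = 0 := fun ω j => by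
      rw [hsum, if_neg htT.ne']
    have hpay : ∀ ω, payout δ F r t₀ t₁ T z ω = θ ω ⬝ᵥ
        (vecExp (logGrowth δ F t₀ t₁ (t + 1) ω) - vecExp (logGrowth δ F t₀ t₁ t ω)) := by
      intro ω
      rw [payout_eq_gains _ _ _ _ _ _ _ (hz0 ω), gains,
        Finset.sum_eq_single_of_mem t (Finset.mem_range.2 htT)]
      · congr 1
        ext j
        have h1 : (0 : ℝ) < (t₁ j : ℝ) - t₀ j := sub_pos.2 (Nat.cast_lt.2 (ht j))
        rw [hsum, if_pos rfl]
        field_simp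
      · intro s _ hs
        simp only [hsum, if_neg hs, mul_zero]
        exact zero_dotProduct _
    have hzm : ∀ s ≤ T, Measurable[ℱ s] (z s) := by
      intro s _
      by_cases hs : t ≤ s
      · refine @measurable_pi_lambda _ _ _ (ℱ s) _ _ fun j => ?_
        have : Measurable[ℱ s] fun ω => θ ω j :=
          (measurable_pi_apply j).comp (hθ.mono (ℱ.mono hs) le_rfl)
        exact (this.const_mul _).const_mul _
      · have : z s = fun _ _ => 0 := by
          ext ω j
          simp [z, show s ≠ t by omega, show s ≠ t + 1 by omega]
        rw [this]
        exact measurable_const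
    have := hNA z hzm (ae_of_all _ hz0) (by simpa only [hpay] using hpos)
    simpa only [hpay] using this
  · intro h z hzm hz hpos
    have hX : ∀ t ≤ T, Measurable[ℱ t] fun ω => vecExp (logGrowth δ F t₀ t₁ t ω) := fun t htT =>
      continuous_vecExp.measurable.comp (measurable_logGrowth (hF t htT))
    have hθ : ∀ t < T, Measurable[ℱ t] fun ω (j : Fin J) =>
        1 / (((t₁ j : ℝ) - t₀ j) * δ) * ∑ s ∈ Finset.range (t + 1), z s ω j := by
      intro t htT
      refine @measurable_pi_lambda _ _ _ (ℱ t) _ _ fun j => ?_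
      refine Measurable.const_mul (Finset.measurable_sum _ fun s hs => ?_) _
      have hs : s ≤ t := Nat.lt_succ_iff.1 (Finset.mem_range.1 hs)
      exact (measurable_pi_apply j).comp ((hzm s (hs.trans htT.le)).mono (ℱ.mono hs) le_rfl)
    have h0 := gains_eq_zero_of_nonneg hX h le_rfl hθ (by
      filter_upwards [hz, hpos] with ω hzω hω
      rwa [← payout_eq_gains δ F r t₀ t₁ T z hzω])
    filter_upwards [hz, h0] with ω hzω hω
    rwa [payout_eq_gains δ F r t₀ t₁ T z hzω]

end Payout

end SofrFutures

theorem mainTheorem2 {Ω : Type*} {mΩ : MeasurableSpace Ω} (P : Measure Ω) [IsProbabilityMeasure P]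
    (ℱ : Filtration ℕ mΩ) (δ : ℝ) (hδ : 0 < δ) (T J : ℕ) (t₀ t₁ : Fin J → ℕ)
    (ht : ∀ j, t₀ j < t₁ j) (hT : ∀ j, T < t₁ j)
    (F : ℕ → ℤ → Ω → ℝ) (hF : ∀ t ≤ T, ∀ s, Measurable[ℱ t] (F t s)) (r : ℕ → Ω → ℝ) :
    SofrFutures.IsArbitrageFree P ℱ δ F r t₀ t₁ T ↔
      ∀ t < T, ∀ᵐ ω ∂P,
        SofrFutures.vecExp (SofrFutures.logGrowth δ F t₀ t₁ t ω) ∈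
          intrinsicInterior ℝ (convexHull ℝ (SofrFutures.vecExp ''
            SofrFutures.condSupport (ℱ t) P (SofrFutures.logGrowth δ F t₀ t₁ (t + 1)) ω)) := by
  rw [SofrFutures.isArbitrageFree_iff_onePeriod hδ ht hF r]
  refine forall₂_congr fun t htT => ?_
  refine SofrFutures.onePeriod_iff (ℱ.le t) P ?_ SofrFutures.continuous_vecExp ?_
  · exact SofrFutures.measurable_logGrowth fun s => (hF (t + 1) htT s).mono (ℱ.le _) le_rfl
  · exact SofrFutures.continuous_vecExp.measurable.comp
      (SofrFutures.measurable_logGrowth (hF t htT.le))
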